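/- Let $\mathbb N=\{1,2,3,\dots\}$, let $\mathcal P_f(X)$ denote the set of all nonempty finite subsets of a set $X$, and let $\tau={}^{\mathbb N}\mathbb N$ be the set of all sequences $f:\mathbb N\to\mathbb N$. For $\beta,\gamma\in\mathcal P_f(\mathbb N)$ write $\beta<\gamma$ if $\max\beta<\min\gamma$. Let $\beta\mathbb N$ be the set of ultrafilters on $\mathbb N$, with the operation given by $A\in p+q$ if and only if $\{x\in\mathbb N:\{y\in\mathbb N:x+y\in A\}\in q\}\in p$; an ultrafilter $p$ is idempotent if $p+p=p$. A set $A\subseteq\mathbb N$ is a $J$-set if for every $F\in\mathcal P_f(\tau)$ there exist $a\in\mathbb N$ and $\beta\in\mathcal P_f(\mathbb N)$ such that $a+\sum_{t\in\beta}f(t)\in A$ for all $f\in F$. Let $\mathcal J$ be the set of all $p\in\beta\mathbb N$ such that every member of $p$ is a $J$-set. For $p\in\beta\mathbb N$, the ultrafilter $\bigotimes_{i=1}^m p$ on $\mathbb N^m$ is defined recursively: $\bigotimes_{i=1}^1p=p$, and for $k\ge1$ and $B\subseteq\mathbb N^{k+1}$, $B\in\bigotimes_{i=1}^{k+1}p$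 if and only if $$\{(x_1,\dots,x_k)\in\mathbb N^k:\{x_{k+1}\in\mathbb N:(x_1,\dots,x_{k+1})\in B\}\in p\}\in\bigotimes_{i=1}^{k}p.$$ **Corollary.** Let $m\in\mathbb N$ and $A\subseteq\mathbb N^m$. The following two statements are equivalent. 1. There exist functions $\alpha:\mathcal P_f(\tau)\to\mathbb N$ and $H:\mathcal P_f(\tau)\to\mathcal P_f(\mathbb N)$ such that - (a) if $F,G\in\mathcal P_f(\tau)$ and $F\subsetneq G$, then $\max H(F)<\min H(G)$; and - (b) whenever $(G_i)_{i\in\mathbb N}$ is a sequence in $\mathcal P_f(\tau)$ with $G_1\subsetneq G_2\subsetneq\cdots\subsetneq G_n\subsetneq\cdots$, then for all $\beta_1<\beta_2<\cdots<\beta_m$ in $\mathcal P_f(\mathbb N)$ and all choices of $f_i\in G_i$ $(i\in\mathbb N)$, $$\left(\sum_{i\in\beta_1}\Bigl(\alpha(G_i)+\sum_{t\in H(G_i)}f_i(t)\Bigr),\ \dots,\ \sum_{i\in\beta_m}\Bigl(\alpha(G_i)+\sum_{t\in H(G_i)}f_i(t)\Bigr)\right)\in A.$$ 2. There exists an idempotent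 $p\in\mathcal J$ such that $A\in\bigotimes_{i=1}^m p$. -/

import Mathlib

/-- `PFin X` is the collection of all nonempty finite subsets of `X`. -/
abbrev PFin (X : Type*) : Type _ := {s : Finset X // s.Nonempty}

/-- `s.Precedes t` means `max s < min t`. -/
def PFin.Precedes (s t : PFin ℕ+) : Prop := s.1.max' s.2 < t.1.min' t.2

/-- The sum `∑ t ∈ s, f t` of positive integers over a nonempty finite set, again a positive
integer. It is computed in `ℕ`, because `ℕ+` has no zero. -/
def PFin.sum {ι : Type*} (s : PFin ι) (f : ι → ℕ+) : ℕ+ :=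
  ⟨∑ t ∈ s.1, (f t : ℕ), Finset.sum_pos (fun t _ => (f t).pos) s.2⟩

/-- `A` is a `J`-set: for every nonempty finite set `F` of sequences of positive integers there
are `a` and a nonempty finite `β` with `a + ∑ t ∈ β, f t ∈ A` for all `f ∈ F`. -/
def IsJSet (A : Set ℕ+) : Prop :=
  ∀ F : PFin (ℕ+ → ℕ+), ∃ (a : ℕ+) (β : PFin ℕ+), ∀ f ∈ F.1, a + β.sum f ∈ A

/-- The set `𝒥` of all ultrafilters on the positive integers all of whose members are `J`-sets. -/
def JUltrafilters : Set (Ultrafilter ℕ+) := {p | ∀ A ∈ p, IsJSet A}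

/-- The tensor product `p₁ ⊗ ⋯ ⊗ pₖ` of ultrafilters on `S`, an ultrafilter on `Sᵏ`. The empty
product is the principal ultrafilter at the only point of `S⁰`. -/
noncomputable def ultrafilterTensor {S : Type*} :
    (k : ℕ) → (Fin k → Ultrafilter S) → Ultrafilter (Fin k → S)
  | 0, _ => pure Fin.elim0
  | k + 1, p =>
    (ultrafilterTensor k (fun i => p i.castSucc)).bind fun x =>
      (p (Fin.last k)).map fun y => Fin.snoc (α := fun _ => S) x y

/-- The recursive membership rule of the tensor product. -/
theorem mem_ultrafilterTensor_succ {S : Type*} (k : ℕ) (p : Fin (k + 1) → Ultrafilter S)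
    (A : Set (Fin (k + 1) → S)) :
    A ∈ ultrafilterTensor (k + 1) p ↔
      {x : Fin k → S | {y : S | Fin.snoc (α := fun _ => S) x y ∈ A} ∈ p (Fin.last k)} ∈
        ultrafilterTensor k (fun i => p i.castSucc) :=
  Iff.rfl

/-- The tensor product of a single ultrafilter is that ultrafilter, with `S¹` identified
with `S`. -/
theorem mem_ultrafilterTensor_one {S : Type*} (p : Fin 1 → Ultrafilter S)
    (A : Set (Fin 1 → S)) :
    A ∈ ultrafilterTensor 1 p ↔ {y : S | (fun _ => y) ∈ A} ∈ p 0 := by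
  rw [mem_ultrafilterTensor_succ]
  change {y : S | Fin.snoc (α := fun _ => S) Fin.elim0 y ∈ A} ∈ p (Fin.last 0) ↔ _
  have h : ∀ y : S, Fin.snoc (α := fun _ => S) Fin.elim0 y = (fun _ : Fin 1 => y) := by
    intro y
    funext i
    have hi : i = Fin.last 0 := Fin.ext (by omega)
    rw [hi, Fin.snoc_last]
  simp only [h]
  rfl

attribute [local instance] Ultrafilter.add

/-- The extension of addition to ultrafilters: `A ∈ p + q` if and only if
`{x | -x + A ∈ q} ∈ p`. -/
theorem mem_ultrafilter_add (p q : Ultrafilter ℕ+) (A : Set ℕ+) :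
    A ∈ p + q ↔ {x : ℕ+ | {y : ℕ+ | x + y ∈ A} ∈ q} ∈ p :=
  Ultrafilter.eventually_add p q (· ∈ A)

/-!
Consider the pairs `(F, f)` where `F` is a nonempty finite set of sequences and `f ∈ F`, order them
by their first components, and attach to `(F, f)` the number `α F + ∑ t ∈ H F, f t`.

From `α` and `H` to `p`: for a pair `e`, let `C e` be the set of all sums of attached numbers along
increasing sequences of pairs that start above `e`. The `C e` are `J`-sets, they decrease in `e`,
and every `x ∈ C e` has an `e'` with `x + C e' ⊆ C e`. By the Hales–Jewett theorem `J`-sets are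
partition regular, so the members of `𝒥` containing every `C e` form a nonempty compact
subsemigroup. It has an idempotent `p`, and since a tuple of block sums can be prolonged by every
element of a suitable `C e`, the tuples of block sums form a member of `⨂ p`.

From `p` to `α` and `H`: because `p + p = p`, membership of `A` in `⨂ p` provides a set of good
tuples such that `p`-almost every `z` can be appended to a good tuple, and can be added to its last
entry. Construct `α F` and `H F` by recursion on `F`. The proper subsets of `F` have produced only
finitely many tuples, so `p`-almost every `z` serves all of them at once, and since `p ∈ 𝒥` there
are `α F` and `H F` such that `α F + ∑ t ∈ H F, f t` is such a `z` for every `f ∈ F`.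
-/

open Set Filter

namespace PFin

variable {ι κ : Type*}

instance [Nonempty ι] : Nonempty (PFin ι) :=
  ‹Nonempty ι›.map fun i => ⟨{i}, Finset.singleton_nonempty i⟩

theorem coe_sum (s : PFin ι) (f : ι → ℕ+) : (s.sum f : ℕ) = ∑ t ∈ s.1, (f t : ℕ) := rfl

theorem sum_congr (s : PFin ι) {f g : ι → ℕ+} (h : ∀ i ∈ s.1, f i = g i) : s.sum f = s.sum g :=
  PNat.coe_injective (Finset.sum_congr rfl fun i hi => by rw [h i hi])

theorem sum_singleton (i : ι) (f : ι → ℕ+) :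
    PFin.sum ⟨{i}, Finset.singleton_nonempty i⟩ f = f i :=
  PNat.coe_injective (Finset.sum_singleton _ _)

theorem sum_union [DecidableEq ι] {s t : PFin ι} (hst : Disjoint s.1 t.1) (f : ι → ℕ+) :
    PFin.sum ⟨s.1 ∪ t.1, s.2.inl⟩ f = s.sum f + t.sum f :=
  PNat.coe_injective (Finset.sum_union hst)

/-- The image of a nonempty finite set under an injection. -/
def map (s : PFin ι) (e : ι ↪ κ) : PFin κ := ⟨s.1.map e, s.2.map⟩

theorem sum_map (s : PFin ι) (e : ι ↪ κ) (f : κ → ℕ+) : (s.map e).sum f = s.sum (f ∘ e) :=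
  PNat.coe_injective (Finset.sum_map _ _ _)

/-- The translate `s + n`. -/
def shift (s : PFin ℕ+) (n : ℕ+) : PFin ℕ+ := s.map (addRightEmbedding n)

theorem sum_shift (s : PFin ℕ+) (n : ℕ+) (f : ℕ+ → ℕ+) :
    (s.shift n).sum f = s.sum fun t => f (t + n) :=
  s.sum_map _ f

theorem lt_of_mem_shift {s : PFin ℕ+} {n t : ℕ+} (ht : t ∈ (s.shift n).1) : n < t := by
  obtain ⟨u, -, rfl⟩ := Finset.mem_map.1 ht
  exact PNat.lt_add_left n u

theorem precedes_iff {s t : PFin ℕ+} : s.Precedes t ↔ ∀ a ∈ s.1, ∀ b ∈ t.1, a < b := by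
  simp only [Precedes, Finset.max'_lt_iff, Finset.lt_min'_iff]
  exact ⟨fun h a ha b hb => h b hb a ha, fun h b hb a ha => h a ha b hb⟩

theorem Precedes.disjoint {s t : PFin ℕ+} (h : s.Precedes t) : Disjoint s.1 t.1 :=
  Finset.disjoint_left.2 fun a ha ha' => (precedes_iff.1 h a ha a ha').false

theorem precedes_shift {s : PFin ℕ+} {n : ℕ+} (h : ∀ t ∈ s.1, t ≤ n) (u : PFin ℕ+) :
    s.Precedes (u.shift n) :=
  precedes_iff.2 fun a ha _ hb => (h a ha).trans_lt (lt_of_mem_shift hb)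

theorem exists_forall_le {κ : Type*} [Finite κ] (β : κ → PFin ℕ+) :
    ∃ n, ∀ j, ∀ t ∈ (β j).1, t ≤ n := by
  obtain ⟨n, hn⟩ := (finite_iUnion fun j => (β j).1.finite_toSet).bddAbove
  exact ⟨n, fun j t ht => hn (mem_iUnion.2 ⟨j, ht⟩)⟩

theorem exists_superset_gt {T : Type*} [Infinite T] (F G : PFin T) :
    ∃ K : PFin T, F.1 ⊆ K.1 ∧ G < K := by
  classical
  obtain ⟨t, ht⟩ := Infinite.exists_notMem_finset (G.1 ∪ F.1)
  refine ⟨⟨insert t (G.1 ∪ F.1), Finset.insert_nonempty _ _⟩,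
    Finset.subset_union_right.trans (Finset.subset_insert _ _), ?_⟩
  exact Finset.subset_union_left.trans_ssubset (Finset.ssubset_insert ht)

theorem finite_Iio {T : Type*} (F : PFin T) : (Iio F).Finite :=
  .of_injOn (t := (F.1.powerset : Set (Finset T))) (fun _ hG => Finset.mem_powerset.2 hG.le)
    Subtype.val_injective.injOn (Finset.finite_toSet _)

end PFin

/-! ### Partition regularity of `J`-sets -/

namespace IsJSet

variable {A B : Set ℕ+}

theorem mono (hA : IsJSet A) (h : A ⊆ B) : IsJSet B := fun F =>
  let ⟨a, β, hβ⟩ := hA F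
  ⟨a, β, fun f hf => h (hβ f hf)⟩

theorem exists_gt (hA : IsJSet A) (F : PFin (ℕ+ → ℕ+)) (N : ℕ+) :
    ∃ (a : ℕ+) (β : PFin ℕ+), (∀ t ∈ β.1, N < t) ∧ ∀ f ∈ F.1, a + β.sum f ∈ A := by
  classical
  obtain ⟨a, β, h⟩ := hA ⟨F.1.image fun f t => f (t + N), F.2.image _⟩
  refine ⟨a, β.shift N, fun t => PFin.lt_of_mem_shift, fun f hf => ?_⟩
  rw [PFin.sum_shift]
  exact h _ (Finset.mem_image_of_mem _ hf)

/-- Apply the definition to the sequences `t ↦ ∑ i, w i (e (t, i))`, where `w` runs over all words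
in `F` and `e` embeds `ℕ+ × ι` into `ℕ+`. -/
theorem exists_forall_word (hA : IsJSet A) (F : PFin (ℕ+ → ℕ+)) (ι : Type*) [Fintype ι]
    [Nonempty ι] :
    ∃ (a : ℕ+) (β : ι → PFin ℕ+), Pairwise (Function.onFun Disjoint fun i => (β i).1) ∧
      ∀ w : ι → ℕ+ → ℕ+, (∀ i, w i ∈ F.1) →
        a + PFin.sum ⟨Finset.univ, Finset.univ_nonempty⟩ (fun i => (β i).sum (w i)) ∈ A := by
  classical
  obtain ⟨e₀⟩ := nonempty_embedding_nat (ℕ+ × ι)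
  let e : ℕ+ × ι ↪ ℕ+ := e₀.trans Equiv.pnatEquivNat.symm.toEmbedding
  let words : Finset (ι → ℕ+ → ℕ+) := Fintype.piFinset fun _ => F.1
  have hwords : words.Nonempty := Fintype.piFinset_nonempty.2 fun _ => F.2
  let g : (ι → ℕ+ → ℕ+) → ℕ+ → ℕ+ := fun w t =>
    PFin.sum ⟨Finset.univ, Finset.univ_nonempty⟩ fun i => w i (e (t, i))
  obtain ⟨a, β, h⟩ := hA ⟨words.image g, hwords.image g⟩
  refine ⟨a, fun i => β.map ((Function.Embedding.sectL ℕ+ i).trans e), fun i j hij => ?_,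
    fun w hw => ?_⟩
  · refine Finset.disjoint_left.2 fun x hi hj => hij ?_
    obtain ⟨t, -, rfl⟩ := Finset.mem_map.1 hi
    obtain ⟨u, -, hu⟩ := Finset.mem_map.1 hj
    exact congrArg Prod.snd (e.injective hu).symm
  · convert h _ (Finset.mem_image_of_mem g (Fintype.mem_piFinset.2 hw)) using 2
    refine PNat.coe_injective ?_
    simp only [PFin.sum_map, PFin.coe_sum, g]
    exact Finset.sum_comm

end IsJSet

/-- The active coordinates of the line contribute to `β'`, the fixed ones to `a'`. -/
theorem exists_add_sum_line_eq {κ ι : Type*} [Fintype ι] [Nonempty ι] [Nonempty κ]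
    (a : ℕ+) {β : ι → PFin ℕ+} (hβ : Pairwise (Function.onFun Disjoint fun i => (β i).1))
    (u : κ → ℕ+ → ℕ+) (l : Combinatorics.Line κ ι) :
    ∃ (a' : ℕ+) (β' : PFin ℕ+), ∀ x : κ,
      a + PFin.sum ⟨Finset.univ, Finset.univ_nonempty⟩ (fun i => (β i).sum (u (l x i))) =
        a' + β'.sum (u x) := by
  classical
  let active : Finset ι := {i | l.idxFun i = none}
  let fixed : Finset ι := {i | ¬ l.idxFun i = none}
  obtain ⟨x₀⟩ := ‹Nonempty κ›
  obtain ⟨i₀, hi₀⟩ := l.proper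
  let a' : ℕ+ := ⟨a + ∑ i ∈ fixed, ((β i).sum (u (l x₀ i)) : ℕ), Nat.add_pos_left a.pos _⟩
  have ha' : (a' : ℕ) = a + ∑ i ∈ fixed, ((β i).sum (u (l x₀ i)) : ℕ) := rfl
  refine ⟨a', ⟨active.biUnion fun i => (β i).1, (β i₀).2.mono
    (Finset.subset_biUnion_of_mem (fun i => (β i).1) (by simpa [active] using hi₀))⟩,
    fun x => PNat.coe_injective ?_⟩
  have hactive : ∑ i ∈ active, ((β i).sum (u (l x i)) : ℕ) =
      ∑ t ∈ active.biUnion fun i => (β i).1, (u x t : ℕ) := by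
    rw [Finset.sum_biUnion fun i _ j _ hij => hβ hij]
    refine Finset.sum_congr rfl fun i hi => ?_
    rw [l.apply_none x i (Finset.mem_filter.1 hi).2, PFin.coe_sum]
  have hfixed : ∑ i ∈ fixed, ((β i).sum (u (l x i)) : ℕ) =
      ∑ i ∈ fixed, ((β i).sum (u (l x₀ i)) : ℕ) := by
    refine Finset.sum_congr rfl fun i hi => ?_
    obtain ⟨y, hy⟩ := Option.ne_none_iff_exists'.1 (Finset.mem_filter.1 hi).2
    simp only [Combinatorics.Line.coe_apply, hy, Option.getD_some]
  rw [PNat.add_coe, PNat.add_coe, PFin.coe_sum, PFin.coe_sum,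
    ← Finset.sum_filter_add_sum_filter_not _ (fun i => l.idxFun i = none), hactive, hfixed, ha']
  ring

namespace IsJSet

variable {A B : Set ℕ+}

theorem exists_forall_mem_or_of_union (h : IsJSet (A ∪ B)) (F : PFin (ℕ+ → ℕ+)) :
    ∃ (a : ℕ+) (β : PFin ℕ+), (∀ f ∈ F.1, a + β.sum f ∈ A) ∨ ∀ f ∈ F.1, a + β.sum f ∈ B := by
  classical
  have : Nonempty F.1 := F.2.to_subtype
  obtain ⟨ι, _, hι⟩ := Combinatorics.Line.exists_mono_in_high_dimension F.1 Prop
  have : Nonempty ι :=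
    let ⟨l, _⟩ := hι fun _ => True
    ⟨l.proper.choose⟩
  obtain ⟨a, β, hβ, hmem⟩ := h.exists_forall_word F ι
  obtain ⟨l, c, hl⟩ := hι fun w =>
    a + PFin.sum ⟨Finset.univ, Finset.univ_nonempty⟩ (fun i => (β i).sum (w i)) ∈ A
  obtain ⟨a', β', heq⟩ := exists_add_sum_line_eq a hβ (Subtype.val : F.1 → ℕ+ → ℕ+) l
  have hunion (f : F.1) : a' + β'.sum f ∈ A ∪ B := heq f ▸ hmem _ fun i => (l f i).2
  have hcolor (f : F.1) : a' + β'.sum f ∈ A ↔ c := heq f ▸ (hl f).to_iff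
  refine ⟨a', β', ?_⟩
  by_cases hc : c
  · exact .inl fun f hf => (hcolor ⟨f, hf⟩).2 hc
  · exact .inr fun f hf => (hunion ⟨f, hf⟩).resolve_left fun hA => hc ((hcolor ⟨f, hf⟩).1 hA)

theorem of_union (h : IsJSet (A ∪ B)) : IsJSet A ∨ IsJSet B := by
  classical
  by_contra! hAB
  simp only [IsJSet, not_forall, not_exists] at hAB
  obtain ⟨⟨F₁, hF₁⟩, ⟨F₂, hF₂⟩⟩ := hAB
  obtain ⟨a, β, hA | hB⟩ := h.exists_forall_mem_or_of_union ⟨F₁.1 ∪ F₂.1, F₁.2.inl⟩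
  · obtain ⟨f, hf, hfA⟩ := hF₁ a β
    exact hfA (hA f (Finset.mem_union_left _ hf))
  · obtain ⟨f, hf, hfB⟩ := hF₂ a β
    exact hfB (hB f (Finset.mem_union_right _ hf))

theorem nonempty (hA : IsJSet A) : A.Nonempty :=
  let ⟨_, _, h⟩ := hA ⟨{1}, Finset.singleton_nonempty 1⟩
  ⟨_, h 1 (Finset.mem_singleton_self 1)⟩

end IsJSet

/-- The filter dual to the ideal of sets that are not `J`-sets. Its ultrafilter refinements are
the members of `𝒥`. -/
def coJFilter : Filter ℕ+ :=
  comk (fun A => ¬ IsJSet A) (fun h => h.nonempty.ne_empty rfl)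
    (fun _ ht _ hst hs => ht (hs.mono hst)) fun _ hs _ ht h => h.of_union.elim hs ht

theorem mem_JUltrafilters_of_le {p : Ultrafilter ℕ+} (h : (p : Filter ℕ+) ≤ coJFilter) :
    p ∈ JUltrafilters := by
  intro A hA
  by_contra hJ
  have : Aᶜ ∈ p := h (mem_comk.2 (by rwa [compl_compl]))
  exact Ultrafilter.compl_mem_iff_notMem.1 this hA

theorem IsJSet.exists_mem_JUltrafilters {A : Set ℕ+} (hA : IsJSet A) :
    ∃ p ∈ JUltrafilters, A ∈ p := by
  have : NeBot (coJFilter ⊓ 𝓟 A) := by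
    refine inf_principal_neBot_iff.2 fun U hU => ?_
    by_contra! hempty
    exact mem_comk.1 hU (hA.mono (disjoint_iff_inter_eq_empty.2 hempty).subset_compl_left)
  have hle := Ultrafilter.of_le (coJFilter ⊓ 𝓟 A)
  exact ⟨Ultrafilter.of (coJFilter ⊓ 𝓟 A), mem_JUltrafilters_of_le (hle.trans inf_le_left),
    le_principal_iff.1 (hle.trans inf_le_right)⟩

theorem isClosed_JUltrafilters : IsClosed JUltrafilters := by
  have : JUltrafilters = ⋂ (A : Set ℕ+) (_ : ¬ IsJSet A), {p : Ultrafilter ℕ+ | Aᶜ ∈ p} := by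
    ext p
    simp only [JUltrafilters, mem_ofPred_eq, mem_iInter, Ultrafilter.compl_mem_iff_notMem]
    exact forall_congr' fun A => not_imp_not.symm
  rw [this]
  exact isClosed_iInter fun A => isClosed_iInter fun _ => ultrafilter_isClosed_basic _

theorem add_mem_JUltrafilters (p : Ultrafilter ℕ+) {q : Ultrafilter ℕ+}
    (hq : q ∈ JUltrafilters) : p + q ∈ JUltrafilters := by
  intro A hA F
  obtain ⟨x, hx⟩ := p.nonempty_of_mem ((mem_ultrafilter_add p q A).1 hA)
  obtain ⟨a, β, h⟩ := hq _ hx F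
  exact ⟨x + a, β, fun f hf => by rw [add_assoc]; exact h f hf⟩

theorem exists_idempotent_mem_JUltrafilters {ι : Type*} [Nonempty ι] {C : ι → Set ℕ+}
    (hJ : ∀ i, IsJSet (C i)) (hdir : Directed (· ⊇ ·) C)
    (hadd : ∀ i, ∀ x ∈ C i, ∃ j, ∀ y ∈ C j, x + y ∈ C i) :
    ∃ p ∈ JUltrafilters, p + p = p ∧ ∀ i, C i ∈ p := by
  let Q : ι → Set (Ultrafilter ℕ+) := fun i => JUltrafilters ∩ {p | C i ∈ p}
  have hclosed (i : ι) : IsClosed (Q i) :=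
    isClosed_JUltrafilters.inter (ultrafilter_isClosed_basic _)
  have hne : (⋂ i, Q i).Nonempty := by
    refine IsCompact.nonempty_iInter_of_directed_nonempty_isCompact_isClosed Q ?_
      (fun i => (hJ i).exists_mem_JUltrafilters) (fun i => (hclosed i).isCompact) hclosed
    intro i j
    obtain ⟨k, hi, hj⟩ := hdir i j
    exact ⟨k, inter_subset_inter_right _ fun _ hp => mem_of_superset hp hi,
      inter_subset_inter_right _ fun _ hp => mem_of_superset hp hj⟩
  let _ : AddSemigroup (Ultrafilter ℕ+) := Ultrafilter.addSemigroup
  obtain ⟨p, hpQ, hp⟩ := exists_idempotent_in_compact_add_subsemigroup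
    Ultrafilter.continuous_add_left (⋂ i, Q i) hne (isClosed_iInter hclosed).isCompact <| by
      refine fun p hp q hq => mem_iInter.2 fun i =>
        ⟨add_mem_JUltrafilters p (mem_iInter.1 hq i).1, ?_⟩
      refine (mem_ultrafilter_add p q _).2 ?_
      filter_upwards [(mem_iInter.1 hp i).2] with x hx
      obtain ⟨j, hj⟩ := hadd i x hx
      exact mem_of_superset (mem_iInter.1 hq j).2 hj
  rw [mem_iInter] at hpQ
  exact ⟨p, (hpQ (Classical.arbitrary ι)).1, hp, fun i => (hpQ i).2⟩

/-! ### Sums along increasing sequences -/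

section ChainSums

variable {E : Type*} [Preorder E]

theorem exists_strictMono_concat {c c' : ℕ+ → E} (hc : StrictMono c) (hc' : StrictMono c')
    {n : ℕ+} (h : c n < c' 1) :
    ∃ d : ℕ+ → E, StrictMono d ∧ (∀ i ≤ n, d i = c i) ∧ ∀ i, d (i + n) = c' i := by
  have hshift (i : ℕ+) : ¬ i + n ≤ n := (PNat.lt_add_left n i).not_ge
  refine ⟨fun i => if i ≤ n then c i else c' (i - n), fun i j hij => ?_,
    fun i hi => if_pos hi, fun i => ?_⟩
  · by_cases hj : j ≤ n
    · simpa only [if_pos hj, if_pos (hij.le.trans hj)] using hc hij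
    have hnj : n + (j - n) = j := PNat.add_sub_of_lt (not_le.1 hj)
    by_cases hi : i ≤ n
    · simpa only [if_pos hi, if_neg hj] using
        (hc.monotone hi).trans_lt (h.trans_le (hc'.monotone one_le))
    · have hni : n + (i - n) = i := PNat.add_sub_of_lt (not_le.1 hi)
      simp only [if_neg hi, if_neg hj]
      exact hc' (lt_of_add_lt_add_left (a := n) (by rwa [hni, hnj]))
  · simp only [if_neg (hshift i), PNat.add_sub]

/-- All sums `∑ i ∈ β, w (c i)` along strictly increasing sequences `c` that start strictly
above `e`. -/
def chainSums (w : E → ℕ+) (e : E) : Set ℕ+ :=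
  {x | ∃ c : ℕ+ → E, StrictMono c ∧ e < c 1 ∧ ∃ β : PFin ℕ+, x = β.sum (w ∘ c)}

/-- All tuples of sums over `β₁ < ⋯ < βₖ` along a common strictly increasing sequence. -/
def blockSums (w : E → ℕ+) (k : ℕ) : Set (Fin k → ℕ+) :=
  {x | ∃ c : ℕ+ → E, StrictMono c ∧ ∃ β : Fin k → PFin ℕ+,
    (∀ i j, i < j → (β i).Precedes (β j)) ∧ x = fun j => (β j).sum (w ∘ c)}

variable {w : E → ℕ+} {e : E} {k : ℕ}

theorem chainSums_antitone (w : E → ℕ+) : Antitone (chainSums w) := by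
  rintro e e' h x ⟨c, hc, hec, hx⟩
  exact ⟨c, hc, h.trans_lt hec, hx⟩

theorem mem_chainSums_of_lt [NoMaxOrder E] {e' : E} (h : e < e') : w e' ∈ chainSums w e := by
  obtain ⟨c, hc, rfl⟩ := Nat.exists_strictMono' e'
  refine ⟨c ∘ PNat.natPred, hc.comp PNat.natPred_strictMono, h,
    ⟨{1}, Finset.singleton_nonempty 1⟩, ?_⟩
  rw [PFin.sum_singleton]
  rfl

theorem exists_forall_add_mem_chainSums {x : ℕ+} (hx : x ∈ chainSums w e) :
    ∃ e', ∀ y ∈ chainSums w e', x + y ∈ chainSums w e := by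
  obtain ⟨c, hc, hec, β, rfl⟩ := hx
  obtain ⟨n, hn⟩ := PFin.exists_forall_le fun _ : Unit => β
  refine ⟨c n, ?_⟩
  rintro _ ⟨c', hc', hcc', γ, rfl⟩
  obtain ⟨d, hd, hdc, hdc'⟩ := exists_strictMono_concat hc hc' hcc'
  refine ⟨d, hd, by rwa [hdc 1 one_le], ⟨β.1 ∪ (γ.shift n).1, β.2.inl⟩, ?_⟩
  rw [PFin.sum_union (PFin.precedes_shift (hn ()) γ).disjoint, PFin.sum_shift]
  exact congrArg₂ (· + ·) (β.sum_congr fun i hi => congrArg w (hdc i (hn () i hi)).symm)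
    (γ.sum_congr fun i _ => congrArg w (hdc' i).symm)

theorem exists_forall_snoc_mem_blockSums {x : Fin k → ℕ+} (hx : x ∈ blockSums w k) :
    ∃ e, ∀ y ∈ chainSums w e,
      Fin.snoc (α := fun _ => ℕ+) x y ∈ blockSums w (k + 1) := by
  obtain ⟨c, hc, β, hβ, rfl⟩ := hx
  obtain ⟨n, hn⟩ := PFin.exists_forall_le β
  refine ⟨c n, ?_⟩
  rintro _ ⟨c', hc', hcc', γ, rfl⟩
  obtain ⟨d, hd, hdc, hdc'⟩ := exists_strictMono_concat hc hc' hcc'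
  refine ⟨d, hd, Fin.snoc β (γ.shift n), fun i j hij => ?_, funext fun j => ?_⟩
  · obtain ⟨i, rfl⟩ := Fin.exists_castSucc_eq.2 (hij.trans_le (Fin.le_last j)).ne
    induction j using Fin.lastCases with
    | last => simpa using PFin.precedes_shift (hn i) γ
    | cast j => simpa using hβ i j hij
  · induction j using Fin.lastCases with
    | last => simp [PFin.sum_shift, Function.comp_def, hdc']
    | cast j =>
      simp only [Fin.snoc_castSucc]
      exact (β j).sum_congr fun i hi => congrArg w (hdc i (hn j i hi)).symm

theorem blockSums_mem_ultrafilterTensor [Nonempty E] {p : Ultrafilter ℕ+}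
    (hp : ∀ e, chainSums w e ∈ p) (k : ℕ) :
    blockSums w k ∈ ultrafilterTensor k fun _ => p := by
  induction k with
  | zero =>
    obtain ⟨_, c, hc, -⟩ := p.nonempty_of_mem (hp (Classical.arbitrary E))
    exact ⟨c, hc, Fin.elim0, fun i => i.elim0, Subsingleton.elim _ _⟩
  | succ k ih =>
    rw [mem_ultrafilterTensor_succ]
    refine mem_of_superset ih fun x hx => ?_
    obtain ⟨e, he⟩ := exists_forall_snoc_mem_blockSums hx
    exact mem_of_superset (hp e) he

end ChainSums

/-- A nonempty finite set together with one of its elements: a pair `(F, f)` with `f ∈ F`. Pairs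
are compared by their first components only. -/
structure PointedFinset (T : Type*) where
  carrier : PFin T
  point : T
  point_mem : point ∈ carrier.1

namespace PointedFinset

variable {T : Type*}

instance : Preorder (PointedFinset T) := Preorder.lift carrier

instance [Nonempty T] : Nonempty (PointedFinset T) :=
  ‹Nonempty T›.map fun t => ⟨⟨{t}, Finset.singleton_nonempty t⟩, t, Finset.mem_singleton_self t⟩

instance [Infinite T] : NoMaxOrder (PointedFinset T) where
  exists_gt e :=
    let ⟨G, hsub, hlt⟩ := PFin.exists_superset_gt e.carrier e.carrier
    ⟨⟨G, e.point, hsub e.point_mem⟩, hlt⟩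

instance : IsDirectedOrder (PointedFinset T) where
  directed e e' := by
    classical
    let u : PFin T := ⟨e.carrier.1 ∪ e'.carrier.1, e.carrier.2.inl⟩
    exact ⟨⟨u, e.point, Finset.mem_union_left _ e.point_mem⟩, Finset.subset_union_left,
      Finset.subset_union_right⟩

instance : WellFoundedLT (PointedFinset T) :=
  ⟨InvImage.wf carrier wellFounded_lt⟩

theorem finite_Iio (e : PointedFinset T) : (Iio e).Finite := by
  refine .of_injOn (f := fun d => (d.carrier, d.point))
    (t := Iio e.carrier ×ˢ (e.carrier.1 : Set T)) (fun d hd => ⟨hd, ?_⟩) ?_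
    (e.carrier.finite_Iio.prod (Finset.finite_toSet _))
  · have hle : d.carrier ≤ e.carrier := le_of_lt hd
    exact hle d.point_mem
  · rintro ⟨F, f, hf⟩ - ⟨G, g, hg⟩ - h
    cases h
    rfl

end PointedFinset

/-- The number `α F + ∑ t ∈ H F, f t` attached to the pair `(F, f)`. -/
def chainValue (α : PFin (ℕ+ → ℕ+) → ℕ+) (H : PFin (ℕ+ → ℕ+) → PFin ℕ+)
    (e : PointedFinset (ℕ+ → ℕ+)) : ℕ+ :=
  α e.carrier + (H e.carrier).sum e.point

section ChainValue

variable (α : PFin (ℕ+ → ℕ+) → ℕ+) (H : PFin (ℕ+ → ℕ+) → PFin ℕ+)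

theorem isJSet_chainSums_chainValue (e : PointedFinset (ℕ+ → ℕ+)) :
    IsJSet (chainSums (chainValue α H) e) := by
  intro F
  obtain ⟨G, hFG, heG⟩ := F.exists_superset_gt e.carrier
  exact ⟨α G, H G, fun f hf => mem_chainSums_of_lt (e' := PointedFinset.mk G f (hFG hf)) heG⟩

theorem exists_idempotent_chainSums_mem :
    ∃ p ∈ JUltrafilters, p + p = p ∧ ∀ e, chainSums (chainValue α H) e ∈ p :=
  exists_idempotent_mem_JUltrafilters (isJSet_chainSums_chainValue α H)
    (chainSums_antitone _).directed_ge fun _ _ => exists_forall_add_mem_chainSums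

variable {α H}

theorem blockSums_chainValue_subset_iff {m : ℕ} {A : Set (Fin m → ℕ+)} :
    blockSums (chainValue α H) m ⊆ A ↔
      ∀ G : ℕ+ → PFin (ℕ+ → ℕ+), (∀ i, (G i).1 ⊂ (G (i + 1)).1) →
        ∀ β : Fin m → PFin ℕ+, (∀ j k, j < k → (β j).Precedes (β k)) →
          ∀ f : ℕ+ → (ℕ+ → ℕ+), (∀ i, f i ∈ (G i).1) →
            (fun j => (β j).sum fun i => α (G i) + (H (G i)).sum (f i)) ∈ A := by
  constructor
  · intro h G hG β hβ f hf
    exact h ⟨fun i => ⟨G i, f i, hf i⟩, strictMono_of_lt_add_one fun i _ => hG i, β, hβ, rfl⟩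
  · rintro h _ ⟨c, hc, β, hβ, rfl⟩
    exact h (fun i => (c i).carrier) (fun i => hc (PNat.lt_add_right i 1)) β hβ
      (fun i => (c i).point) fun i => (c i).point_mem

end ChainValue

/-! ### Stable trees of idempotent ultrafilters -/

theorem reverse_ofFn_succ {S : Type*} {k : ℕ} (x : Fin (k + 1) → S) :
    (List.ofFn x).reverse = x (Fin.last k) :: (List.ofFn fun i => x i.castSucc).reverse := by
  rw [List.ofFn_succ', List.concat_eq_append, List.reverse_append]
  rfl

theorem exists_reverse_ofFn_eq {S : Type*} {l : List S} {k : ℕ} (h : l.length = k) :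
    ∃ x : Fin k → S, (List.ofFn x).reverse = l := by
  obtain ⟨n, x, hx⟩ := List.exists_iff_exists_tuple.1 ⟨l.reverse, rfl⟩
  obtain rfl : n = k := by rw [← h, ← l.length_reverse, hx, List.length_ofFn]
  exact ⟨x, by rw [← hx, List.reverse_reverse]⟩

theorem exists_tree_of_mem_ultrafilterTensor {S : Type*} {p : Ultrafilter S} {m : ℕ}
    {A : Set (Fin m → S)} (hA : A ∈ ultrafilterTensor m fun _ => p) :
    ∃ W : Set (List S), [] ∈ W ∧ (∀ l ∈ W, ∀ᶠ y in p, y :: l ∈ W) ∧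
      ∀ x : Fin m → S, (List.ofFn x).reverse ∈ W → x ∈ A := by
  induction m with
  | zero =>
    refine ⟨univ, mem_univ _, fun _ _ => .of_forall fun _ => mem_univ _, fun x _ => ?_⟩
    rw [Subsingleton.elim x Fin.elim0]
    exact hA
  | succ m ih =>
    obtain ⟨W, hnil, hcons, hW⟩ := ih ((mem_ultrafilterTensor_succ _ _ _).1 hA)
    -- `W` governs the tuples of length at most `m`, `A` those of length `m + 1`; longer tuples are
    -- all included, so that prolongation never fails.
    refine ⟨{l | (l.length ≤ m → l ∈ W) ∧ ∀ x : Fin (m + 1) → S, (List.ofFn x).reverse = l → x ∈ A},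
      ⟨fun _ => hnil, fun x hx => by simp at hx⟩, fun l ⟨hl, _⟩ => ?_, fun x hx => hx.2 x rfl⟩
    have hlength {y : S} {x : Fin (m + 1) → S} (hx : (List.ofFn x).reverse = y :: l) :
        l.length = m := by simpa [eq_comm] using congrArg List.length hx
    rcases lt_trichotomy l.length m with hlt | heq | hgt
    · filter_upwards [hcons l (hl hlt.le)] with y hy
      exact ⟨fun _ => hy, fun x hx => absurd (hlength hx) hlt.ne⟩
    · obtain ⟨x₀, rfl⟩ := exists_reverse_ofFn_eq heq
      have hx₀ : ∀ᶠ y in p, Fin.snoc (α := fun _ => S) x₀ y ∈ A := hW x₀ (hl heq.le)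
      filter_upwards [hx₀] with y hy
      refine ⟨fun h => absurd heq (Nat.lt_of_succ_le h).ne, fun x hx => ?_⟩
      rw [reverse_ofFn_succ, List.cons.injEq] at hx
      obtain ⟨rfl, hinit⟩ := hx
      obtain rfl := List.ofFn_injective (List.reverse_injective hinit)
      rwa [← Fin.snoc_init_self x]
    · exact .of_forall fun y => ⟨fun h => absurd hgt (Nat.lt_of_succ_le h).not_gt,
        fun x hx => absurd (hlength hx) hgt.ne'⟩

/-- The tuple `l`, whose newest entry is its head, stays in `W` both when `z` is appended as a new
entry and when `z` is added to the newest entry; the latter leaves the empty tuple unchanged. -/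
def Admits {S : Type*} [Add S] (W : Set (List S)) (l : List S) (z : S) : Prop :=
  z :: l ∈ W ∧ l.modifyHead (· + z) ∈ W

/-- A set of tuples that contains the empty tuple and each of whose members admits `p`-almost
every `z`. -/
def IsStableTree {S : Type*} [Add S] (p : Ultrafilter S) (W : Set (List S)) : Prop :=
  [] ∈ W ∧ ∀ l ∈ W, ∀ᶠ z in p, Admits W l z

theorem exists_isStableTree_subset {S : Type*} [AddSemigroup S] {p : Ultrafilter S}
    (hp : p + p = p) {W : Set (List S)} (hnil : [] ∈ W)
    (hcons : ∀ l ∈ W, ∀ᶠ y in p, y :: l ∈ W) : ∃ W' ⊆ W, IsStableTree p W' := by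
  have hadd {P : S → Prop} (h : ∀ᶠ z in p, P z) : ∀ᶠ y in p, ∀ᶠ z in p, P (y + z) :=
    (Ultrafilter.eventually_add p p P).1 (hp.symm ▸ h)
  refine ⟨{l ∈ W | ∀ y l', l = y :: l' → ∀ᶠ z in p, (y + z) :: l' ∈ W}, fun _ hl => hl.1,
    ⟨hnil, by simp⟩, ?_⟩
  rintro l ⟨hl, hhead⟩
  have hnew : ∀ᶠ z in p, z :: l ∈ W := hcons l hl
  refine .and ?_ ?_
  · filter_upwards [hnew, hadd hnew] with z hz hz'
    refine ⟨hz, ?_⟩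
    rintro _ _ ⟨⟩
    exact hz'
  · cases l with
    | nil => exact .of_forall fun _ => ⟨hnil, by simp⟩
    | cons y l =>
      have hold : ∀ᶠ z in p, (y + z) :: l ∈ W := hhead y l rfl
      filter_upwards [hold, hadd hold] with z hz hz'
      refine ⟨hz, ?_⟩
      rintro _ _ ⟨⟩
      simpa only [add_assoc] using hz'

section Reach

variable {E S : Type*} [Preorder E] [Add S] {w w' : E → S} {e : E} {l : List S}

/-- `Reach w e l` says that the tuple `l` can be built along a finite strictly increasing sequence
below `e`, each term `d` of which either appends a new entry `w d` or adds `w d` to the newest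
entry, the head of the list. -/
inductive Reach (w : E → S) : E → List S → Prop
  | nil (e : E) : Reach w e []
  | cons {e e' : E} {l : List S} : Reach w e l → e < e' → Reach w e' (w e :: l)
  | extend {e e' : E} {l : List S} :
    Reach w e l → e < e' → Reach w e' (l.modifyHead (· + w e))

theorem Reach.congr (h : Reach w e l) (hw : EqOn w w' (Iio e)) : Reach w' e l := by
  induction h with
  | nil e => exact .nil e
  | cons _ he ih => exact hw he ▸ (ih fun _ hd => hw (hd.trans he)).cons he
  | extend _ he ih => exact hw he ▸ (ih fun _ hd => hw (hd.trans he)).extend he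

theorem finite_setOf_reach [WellFoundedLT E] (hfin : ∀ e : E, (Iio e).Finite) (w : E → S) (e : E) :
    {l | Reach w e l}.Finite := by
  induction e using WellFoundedLT.induction with
  | ind e ih =>
    refine ((finite_singleton []).union ((hfin e).biUnion fun d hd =>
      ((ih d hd).image (w d :: ·)).union ((ih d hd).image (List.modifyHead (· + w d))))).subset ?_
    rintro _ (_ | ⟨h, hd⟩ | ⟨h, hd⟩)
    · exact .inl rfl
    · exact .inr (mem_biUnion hd (.inl ⟨_, h, rfl⟩))
    · exact .inr (mem_biUnion hd (.inr ⟨_, h, rfl⟩))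

theorem Reach.mem {W : Set (List S)} (hnil : [] ∈ W)
    (hW : ∀ e l, Reach w e l → l ∈ W → Admits W l (w e))
    (h : Reach w e l) : l ∈ W := by
  induction h with
  | nil => exact hnil
  | cons h _ ih => exact (hW _ _ h ih).1
  | extend h _ ih => exact (hW _ _ h ih).2

end Reach

section ReachBlockSums

variable {E : Type*} [Preorder E] {w : E → ℕ+} {c : ℕ+ → E}

theorem Reach.cons_sum (hc : StrictMono c) {l : List ℕ+} (β : PFin ℕ+)
    (hl : ∀ i ∈ β.1, Reach w (c i) l) {n : ℕ+} (hn : ∀ i ∈ β.1, i < n) :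
    Reach w (c n) (β.sum (w ∘ c) :: l) := by
  obtain ⟨s, hs⟩ := β
  induction s using Finset.induction_on_max generalizing n with
  | empty => exact absurd hs Finset.not_nonempty_empty
  | insert a s ha ih =>
    have hlast : c a < c n := hc (hn a (Finset.mem_insert_self a s))
    obtain rfl | hs' := s.eq_empty_or_nonempty
    · simpa only [insert_empty_eq, PFin.sum_singleton, Function.comp_apply] using
        (hl a (Finset.mem_insert_self a ∅)).cons hlast
    · have hsum : PFin.sum ⟨insert a s, hs⟩ (w ∘ c) = PFin.sum ⟨s, hs'⟩ (w ∘ c) + w (c a) := by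
        refine PNat.coe_injective ?_
        rw [PFin.coe_sum, Finset.sum_insert fun h => (ha a h).false, add_comm]
        rfl
      rw [hsum]
      exact (ih hs' (fun i hi => hl i (Finset.mem_insert_of_mem hi)) ha).extend hlast

theorem reach_blockSums (hc : StrictMono c) {k : ℕ} {β : Fin k → PFin ℕ+}
    (hβ : ∀ i j, i < j → (β i).Precedes (β j)) {n : ℕ+} (hn : ∀ j, ∀ i ∈ (β j).1, i < n) :
    Reach w (c n) (List.ofFn fun j => (β j).sum (w ∘ c)).reverse := by
  induction k generalizing n with
  | zero => exact .nil _
  | succ k ih =>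
    rw [reverse_ofFn_succ]
    refine Reach.cons_sum hc _ (fun i hi => ?_) (hn _)
    exact ih (fun i j hij => hβ _ _ (Fin.castSucc_lt_castSucc_iff.2 hij)) fun j t ht =>
      PFin.precedes_iff.1 (hβ _ _ (Fin.castSucc_lt_last j)) t ht i hi

theorem blockSums_subset_of_reach {k : ℕ} {W : Set (List ℕ+)} {A : Set (Fin k → ℕ+)}
    (hreach : ∀ e l, Reach w e l → l ∈ W)
    (hA : ∀ x : Fin k → ℕ+, (List.ofFn x).reverse ∈ W → x ∈ A) : blockSums w k ⊆ A := by
  rintro _ ⟨c, hc, β, hβ, rfl⟩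
  obtain ⟨n, hn⟩ := PFin.exists_forall_le β
  exact hA _ (hreach _ _ (reach_blockSums hc hβ fun j i hi => PNat.lt_add_one_iff.2 (hn j i hi)))

end ReachBlockSums

/-! ### Recursive construction of `α` and `H` -/

theorem exists_forall_of_wellFoundedLT {ι X : Type*} [Preorder ι] [WellFoundedLT ι] [Nonempty X]
    {P : ι → (ι → X) → X → Prop}
    (hcongr : ∀ i g g' x, EqOn g g' (Iio i) → P i g x → P i g' x) (hex : ∀ i g, ∃ x, P i g x) :
    ∃ φ : ι → X, ∀ i, P i φ (φ i) := by
  classical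
  choose x hx using hex
  let extend (i : ι) (g : ∀ j, j < i → X) (j : ι) : X :=
    if h : j < i then g j h else Classical.arbitrary X
  let φ : ι → X := wellFounded_lt.fix fun i g => x i (extend i g)
  have hφ (i : ι) : φ i = x i (extend i fun j _ => φ j) := wellFounded_lt.fix_eq _ i
  refine ⟨φ, fun i => hφ i ▸ hcongr i _ φ _ (fun j hj => dif_pos hj) (hx i _)⟩

theorem exists_precedes_forall_admits {p : Ultrafilter ℕ+} (hJ : p ∈ JUltrafilters)
    {W : Set (List ℕ+)} (hW : IsStableTree p W) (w : PointedFinset (ℕ+ → ℕ+) → ℕ+)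
    (H : PFin (ℕ+ → ℕ+) → PFin ℕ+) (F : PFin (ℕ+ → ℕ+)) :
    ∃ (a : ℕ+) (β : PFin ℕ+), (∀ G < F, (H G).Precedes β) ∧
      ∀ f (hf : f ∈ F.1) l, Reach w ⟨F, f, hf⟩ l → l ∈ W → Admits W l (a + β.sum f) := by
  let reached : Set (List ℕ+) := ⋃ f : F.1, {l | Reach w ⟨F, f.1, f.2⟩ l}
  have hfin : reached.Finite :=
    finite_iUnion fun f => finite_setOf_reach PointedFinset.finite_Iio w _
  have hgood : {z | ∀ l ∈ reached, l ∈ W → Admits W l z} ∈ p :=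
    (eventually_all_finite hfin).2 fun l _ => eventually_imp_distrib_left.2 (hW.2 l)
  have := F.finite_Iio.to_subtype
  obtain ⟨N, hN⟩ := PFin.exists_forall_le fun G : Iio F => H G
  obtain ⟨a, β, hβ, hmem⟩ := (hJ _ hgood).exists_gt F N
  refine ⟨a, β, fun G hG => PFin.precedes_iff.2 fun s hs t ht => ?_, fun f hf l hl => ?_⟩
  · exact (hN ⟨G, hG⟩ s hs).trans_lt (hβ t ht)
  · exact hmem f hf l (mem_iUnion.2 ⟨⟨f, hf⟩, hl⟩)

theorem exists_forall_reach_mem {p : Ultrafilter ℕ+} (hJ : p ∈ JUltrafilters)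
    {W : Set (List ℕ+)} (hW : IsStableTree p W) :
    ∃ (α : PFin (ℕ+ → ℕ+) → ℕ+) (H : PFin (ℕ+ → ℕ+) → PFin ℕ+),
      (∀ F G, F < G → (H F).Precedes (H G)) ∧ ∀ e l, Reach (chainValue α H) e l → l ∈ W := by
  let P (F : PFin (ℕ+ → ℕ+)) (g : PFin (ℕ+ → ℕ+) → ℕ+ × PFin ℕ+) (v : ℕ+ × PFin ℕ+) : Prop :=
    (∀ G < F, (g G).2.Precedes v.2) ∧
      ∀ f (hf : f ∈ F.1) l, Reach (chainValue (Prod.fst ∘ g) (Prod.snd ∘ g)) ⟨F, f, hf⟩ l →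
        l ∈ W → Admits W l (v.1 + v.2.sum f)
  have hcongr : ∀ F g g' v, EqOn g g' (Iio F) → P F g v → P F g' v := by
    rintro F g g' v hg ⟨hprec, hadmits⟩
    refine ⟨fun G hG => hg hG ▸ hprec G hG, fun f hf l hl => hadmits f hf l ?_⟩
    exact hl.congr fun e he => by simp only [chainValue, Function.comp_apply, hg (mem_Iio.1 he)]
  have hex (F : PFin (ℕ+ → ℕ+)) (g : PFin (ℕ+ → ℕ+) → ℕ+ × PFin ℕ+) : ∃ v, P F g v :=
    let ⟨a, β, h⟩ := exists_precedes_forall_admits hJ hW _ (Prod.snd ∘ g) F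
    ⟨(a, β), h⟩
  obtain ⟨φ, hφ⟩ := exists_forall_of_wellFoundedLT hcongr hex
  exact ⟨Prod.fst ∘ φ, Prod.snd ∘ φ, fun F G hFG => (hφ G).1 F hFG, fun e l =>
    Reach.mem hW.1 fun e => (hφ e.carrier).2 e.point e.point_mem⟩

theorem exists_blockSums_chainValue_subset {p : Ultrafilter ℕ+} (hJ : p ∈ JUltrafilters)
    (hp : p + p = p) {m : ℕ} {A : Set (Fin m → ℕ+)}
    (hA : A ∈ ultrafilterTensor m fun _ => p) :
    ∃ (α : PFin (ℕ+ → ℕ+) → ℕ+) (H : PFin (ℕ+ → ℕ+) → PFin ℕ+),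
      (∀ F G, F < G → (H F).Precedes (H G)) ∧ blockSums (chainValue α H) m ⊆ A := by
  obtain ⟨W, hnil, hcons, hWA⟩ := exists_tree_of_mem_ultrafilterTensor hA
  obtain ⟨W', hsub, hstable⟩ := exists_isStableTree_subset hp hnil hcons
  obtain ⟨α, H, hH, hreach⟩ := exists_forall_reach_mem hJ hstable
  exact ⟨α, H, hH, blockSums_subset_of_reach hreach fun x hx => hWA x (hsub hx)⟩

theorem corollary1p17 (m : ℕ) (hm : 1 ≤ m) (A : Set (Fin m → ℕ+)) :
    (∃ (α : PFin (ℕ+ → ℕ+) → ℕ+) (H : PFin (ℕ+ → ℕ+) → PFin ℕ+),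
      (∀ F G : PFin (ℕ+ → ℕ+), F.1 ⊂ G.1 → (H F).Precedes (H G)) ∧
      (∀ G : ℕ+ → PFin (ℕ+ → ℕ+), (∀ i, (G i).1 ⊂ (G (i + 1)).1) →
        ∀ β : Fin m → PFin ℕ+, (∀ j k, j < k → (β j).Precedes (β k)) →
          ∀ f : ℕ+ → (ℕ+ → ℕ+), (∀ i, f i ∈ (G i).1) →
            (fun j => (β j).sum fun i => α (G i) + (H (G i)).sum (f i)) ∈ A)) ↔
    ∃ p : Ultrafilter ℕ+, p ∈ JUltrafilters ∧ p + p = p ∧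
      A ∈ ultrafilterTensor m (fun _ => p) := by
  constructor
  · rintro ⟨α, H, -, hA⟩
    obtain ⟨p, hJ, hp, hsums⟩ := exists_idempotent_chainSums_mem α H
    exact ⟨p, hJ, hp, mem_of_superset (blockSums_mem_ultrafilterTensor hsums m)
      (blockSums_chainValue_subset_iff.2 hA)⟩
  · rintro ⟨p, hJ, hp, hA⟩
    obtain ⟨α, H, hH, hsub⟩ := exists_blockSums_chainValue_subset hJ hp hA
    exact ⟨α, H, hH, blockSums_chainValue_subset_iff.1 hsub⟩
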